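/- Let $K\subset\mathbb C$ be a non-empty compact set, $(\Omega,\mathcal A)$ a measurable space, and $f:\Omega\times K\to\mathbb C$ a random function on $K$, i.e. a function such that $f(\cdot,z)$ is measurable for each $z\in K$. Suppose that for each $\omega\in\Omega$ there are an open neighborhood $U_\omega$ of $K$ and a holomorphic function $g_\omega:U_\omega\to\mathbb C$ with $g_\omega|_K=f(\omega,\cdot)$. Then $f\in R_\Omega^{\mathrm{unif}}(K)$. That is, $f$ is a random function on $K$ such that, for each $\omega\in\Omega$, $f(\omega,\cdot)$ is continuous on $K$ and holomorphic on the interior of $K$, and for every $\varepsilon>0$ there is a random rational function $r$ pole-free on $K$ such that $$|r(\omega,z)-f(\omega,z)|<\varepsilon\qquad\text{for all }(\omega,z)\in\Omega\times K.$$ Here a random rational function pole-free on $K$ is a function $r:\Omega\times K\to\mathbb C$ such that $r(\cdot,z)$ is measurable for each $z\in K$ and, for each $\omega\in\Omega$, $r(\omega,\cdot)$ is the restriction to $K$ of a rational function having no poles on $K$. -/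

import Mathlib

namespace RandomRunge

/-- A function `f : Ω × X → Z` (written in curried form) is a random function on `X` if
`f(·, x)` is measurable for each `x`. -/
def IsRandomFunction {Ω X Z : Type*} [MeasurableSpace Ω] [MeasurableSpace Z]
    (f : Ω → X → Z) : Prop :=
  ∀ x : X, Measurable (fun ω => f ω x)

/-- `r : K → ℂ` is (the restriction to `K` of) a rational function without poles on `K`:
a quotient of two polynomials whose denominator has no zero on `K`. -/
def IsRationalPoleFree (K : Set ℂ) (r : K → ℂ) : Prop :=
  ∃ p q : Polynomial ℂ, ∀ z : K, q.eval (z : ℂ) ≠ 0 ∧ r z = p.eval (z : ℂ) / q.eval (z : ℂ)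

/-- A random rational function pole-free on `K`: a random function on `K` such that, for each `ω`,
`r(ω, ·)` is a rational function pole-free on `K`. -/
def IsRandomRationalPoleFree {Ω : Type*} [MeasurableSpace Ω] (K : Set ℂ)
    (r : Ω → K → ℂ) : Prop :=
  IsRandomFunction r ∧ ∀ ω, IsRationalPoleFree K (r ω)

/-- `h : K → ℂ` is holomorphic on the interior of `K`. -/
def IsHolomorphicOnInterior (K : Set ℂ) (h : K → ℂ) : Prop :=
  ∃ g : ℂ → ℂ, DifferentiableOn ℂ g (interior K) ∧
    ∀ z : K, (z : ℂ) ∈ interior K → h z = g z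

/-- `h : K → ℂ` is the restriction to `K` of a function holomorphic on some open
neighborhood of `K`. -/
def ExtendsHolomorphically (K : Set ℂ) (h : K → ℂ) : Prop :=
  ∃ (U : Set ℂ) (g : ℂ → ℂ), IsOpen U ∧ K ⊆ U ∧ DifferentiableOn ℂ g U ∧
    ∀ z : K, h z = g z

/-- The class `R_Ω^unif(K)`: random functions `f` on `K`, continuous on `K` and holomorphic on the
interior of `K` for each `ω`, which can be approximated uniformly on `Ω × K` by random rational
functions pole-free on `K`. -/
def RUnif (Ω : Type*) [MeasurableSpace Ω] (K : Set ℂ) : Set (Ω → K → ℂ) :=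
  {f | IsRandomFunction f ∧
    (∀ ω, Continuous (f ω)) ∧
    (∀ ω, IsHolomorphicOnInterior K (f ω)) ∧
    ∀ ε : ℝ, 0 < ε → ∃ r : Ω → K → ℂ, IsRandomRationalPoleFree K r ∧
      ∀ (ω : Ω) (z : K), ‖r ω z - f ω z‖ < ε}

end RandomRunge

namespace RandomRunge

open MeasureTheory Set Filter Topology Complex

/-! For fixed `ω`, Runge's theorem comes from Cauchy–Pompeiu: with `φ` a cut-off of the extension
`g`, `g z` is a multiple of `∫ dbar φ w / (w - z)` for `z ∈ K`. Since `dbar φ` vanishes near `K`,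
this is a `C(K, ℂ)`-valued integral of rational functions with poles off `K`, hence lies in their
closure (`mem_closure_rationalSubmodule`). Measurability in `ω` comes from separability of `C(K,
ℂ)`: choose the first good approximant in a fixed dense sequence of rational functions
(`exists_randomFunction_approx`). -/

/-- Twice the Wirtinger derivative `∂̄φ`. -/
noncomputable def dbar (φ : ℂ → ℂ) (w : ℂ) : ℂ :=
  fderiv ℝ φ w 1 + I * fderiv ℝ φ w I

lemma dbar_congr {φ ψ : ℂ → ℂ} {w : ℂ} (h : φ =ᶠ[𝓝 w] ψ) : dbar φ w = dbar ψ w := by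
  simp only [dbar, h.fderiv_eq]

lemma dbar_eq_zero {φ : ℂ → ℂ} {w : ℂ} (h : DifferentiableAt ℂ φ w) : dbar φ w = 0 := by
  have h1 : fderiv ℝ φ w = (fderiv ℂ φ w).restrictScalars ℝ :=
    (h.hasFDerivAt.restrictScalars ℝ).fderiv
  have h2 : fderiv ℂ φ w I = I * fderiv ℂ φ w 1 := by
    simp [← smul_eq_mul]
  simp only [dbar, h1, ContinuousLinearMap.coe_restrictScalars', h2, ← mul_assoc, I_mul_I]
  ring

lemma dbar_mul {φ ψ : ℂ → ℂ} {w : ℂ} (hφ : DifferentiableAt ℝ φ w)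
    (hψ : DifferentiableAt ℂ ψ w) : dbar (fun x => φ x * ψ x) w = dbar φ w * ψ w := by
  have h0 := dbar_eq_zero hψ
  have hψ' : DifferentiableAt ℝ ψ w := hψ.restrictScalars ℝ
  simp only [dbar, fderiv_fun_mul hφ hψ'] at h0 ⊢
  simp only [add_apply, FunLike.coe_smul, Pi.smul_apply, smul_eq_mul]
  linear_combination φ w * h0

lemma dbar_sub {φ ψ : ℂ → ℂ} {w : ℂ} (hφ : DifferentiableAt ℝ φ w)
    (hψ : DifferentiableAt ℝ ψ w) : dbar (fun x => φ x - ψ x) w = dbar φ w - dbar ψ w := by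
  simp only [dbar, fderiv_fun_sub hφ hψ, sub_apply]
  ring

lemma continuous_dbar {φ : ℂ → ℂ} (h : ContDiff ℝ 1 φ) : Continuous (dbar φ) := by
  have := h.continuous_fderiv one_ne_zero
  unfold dbar
  fun_prop

lemma hasCompactSupport_dbar {φ : ℂ → ℂ} (h : HasCompactSupport φ) :
    HasCompactSupport (dbar φ) := by
  refine (h.fderiv (𝕜 := ℝ)).comp_left (g := fun L : ℂ →L[ℝ] ℂ => L 1 + I * L I) ?_
  simp

lemma integral_fderiv_eq_zero {φ : ℂ → ℂ} (h : ContDiff ℝ 1 φ) (hc : HasCompactSupport φ)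
    (v : ℂ) : ∫ w, fderiv ℝ φ w v = 0 := by
  have hi : Integrable (fun w => fderiv ℝ φ w v) :=
    Continuous.integrable_of_hasCompactSupport
      ((h.continuous_fderiv one_ne_zero).clm_apply continuous_const) (hc.fderiv_apply ℝ v)
  have := integral_smul_fderiv_eq_neg_fderiv_smul_of_integrable (μ := volume)
    (f := fun _ : ℂ => (1 : ℝ)) (g := φ) (v := v) (by simp) (by simpa using hi)
    (by simpa using h.continuous.integrable_of_hasCompactSupport hc)
    (by simp) (fun x _ => h.differentiable one_ne_zero x)
  simpa using this

lemma integral_dbar_eq_zero {φ : ℂ → ℂ} (h : ContDiff ℝ 1 φ) (hc : HasCompactSupport φ) :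
    ∫ w, dbar φ w = 0 := by
  have hi (v : ℂ) : Integrable (fun w => fderiv ℝ φ w v) :=
    Continuous.integrable_of_hasCompactSupport
      ((h.continuous_fderiv one_ne_zero).clm_apply continuous_const) (hc.fderiv_apply ℝ v)
  simp only [dbar]
  rw [integral_add (hi 1) ((hi I).const_mul I), integral_const_mul,
    integral_fderiv_eq_zero h hc, integral_fderiv_eq_zero h hc]
  simp

/-! ### The normalizing constant, from a radial bump -/

/-- A smooth function of `t` equal to `1` for `t ≤ 1` and to `0` for `t ≥ 2`. -/
noncomputable def cutoff (t : ℝ) : ℝ := Real.smoothTransition (2 - t)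

lemma contDiff_cutoff {n : ℕ∞} : ContDiff ℝ n cutoff :=
  Real.smoothTransition.contDiff.comp (by fun_prop)

lemma cutoff_of_le {t : ℝ} (h : t ≤ 1) : cutoff t = 1 :=
  Real.smoothTransition.one_of_one_le (by linarith)

lemma cutoff_of_ge {t : ℝ} (h : 2 ≤ t) : cutoff t = 0 :=
  Real.smoothTransition.zero_of_nonpos (by linarith)

lemma deriv_cutoff_of_gt {t : ℝ} (h : 2 < t) : deriv cutoff t = 0 := by
  have : cutoff =ᶠ[𝓝 t] fun _ => 0 := by
    filter_upwards [lt_mem_nhds h] with s hs using cutoff_of_ge hs.le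
  simp [this.deriv_eq]

/-- A radial bump function on `ℂ` equal to `1` near `0`. -/
noncomputable def radialBump (w : ℂ) : ℂ := (cutoff (‖w‖ ^ 2) : ℝ)

lemma contDiff_radialBump : ContDiff ℝ 1 radialBump :=
  ofRealCLM.contDiff.comp ((contDiff_cutoff (n := 1)).comp (contDiff_norm_sq ℝ))

lemma radialBump_eventuallyEq : radialBump =ᶠ[𝓝 0] fun _ => 1 := by
  filter_upwards [Metric.ball_mem_nhds (0 : ℂ) one_pos] with w hw
  have : ‖w‖ < 1 := by simpa using hw
  simp [radialBump, cutoff_of_le (t := ‖w‖ ^ 2) (by nlinarith [norm_nonneg w])]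

lemma hasCompactSupport_radialBump : HasCompactSupport radialBump := by
  refine HasCompactSupport.intro (isCompact_closedBall (0 : ℂ) 2) fun w hw => ?_
  have : 2 < ‖w‖ := by simpa using hw
  simp [radialBump, cutoff_of_ge (t := ‖w‖ ^ 2) (by nlinarith)]

/-- The factor `w` cancels the Cauchy kernel `1 / w`, leaving a radial integrand. -/
lemma dbar_radialBump (w : ℂ) :
    dbar radialBump w = 2 * (deriv cutoff (‖w‖ ^ 2) : ℝ) * w := by
  have h1 : HasFDerivAt (fun x : ℂ => ‖x‖ ^ 2) (2 • innerSL ℝ w) w :=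
    (hasStrictFDerivAt_norm_sq w).hasFDerivAt
  have h2 : HasDerivAt cutoff (deriv cutoff (‖w‖ ^ 2)) (‖w‖ ^ 2) :=
    ((contDiff_cutoff (n := 1)).differentiable one_ne_zero _).hasDerivAt
  have h3 := ofRealCLM.hasFDerivAt.comp w (h2.comp_hasFDerivAt w h1)
  have h4 : fderiv ℝ radialBump w = _ := h3.fderiv
  simp only [dbar, h4]
  apply Complex.ext <;> simp [Complex.inner] <;> ring

/-- In polar coordinates the integrand is exact: the value is `π` times the total change of
`cutoff`, from `1` to `0`. -/
lemma integral_deriv_cutoff_norm_sq : ∫ w : ℂ, deriv cutoff (‖w‖ ^ 2) = -Real.pi := by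
  have hc : Continuous (deriv cutoff) := (contDiff_cutoff (n := 1)).continuous_deriv le_rfl
  have key : ∫ y in Ioi (0 : ℝ), 2 * (y * deriv cutoff (y ^ 2)) = 0 - cutoff (0 ^ 2) := by
    refine integral_Ioi_of_hasDerivAt_of_tendsto' (f := fun y => cutoff (y ^ 2)) ?_ ?_ ?_
    · intro y _
      have h2 : HasDerivAt cutoff (deriv cutoff (y ^ 2)) (y ^ 2) :=
        ((contDiff_cutoff (n := 1)).differentiable one_ne_zero _).hasDerivAt
      exact (h2.comp (h := fun y => y ^ 2) y (hasDerivAt_pow 2 y)).congr_deriv (by simp; ring)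
    · refine (Continuous.integrable_of_hasCompactSupport (by fun_prop) ?_).integrableOn
      refine HasCompactSupport.intro (isCompact_Icc (a := (-2 : ℝ)) (b := 2)) fun y hy => ?_
      rw [deriv_cutoff_of_gt, mul_zero, mul_zero]
      by_contra! h
      exact hy ⟨by nlinarith, by nlinarith⟩
    · refine tendsto_const_nhds.congr' ?_
      filter_upwards [eventually_ge_atTop 2] with y hy
      rw [cutoff_of_ge]; nlinarith
  rw [integral_const_mul, zero_pow two_ne_zero, cutoff_of_le zero_le_one] at key
  rw [integral_fun_norm_addHaar volume (fun y => deriv cutoff (y ^ 2))]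
  simp only [Complex.finrank_real_complex, Nat.add_one_sub_one, pow_one, smul_eq_mul,
    nsmul_eq_mul, Measure.real, Complex.volume_ball]
  simp
  linear_combination Real.pi * key

lemma integral_dbar_radialBump_div (z : ℂ) :
    ∫ w, dbar (fun x => radialBump (x - z)) w / (w - z) = -(2 * Real.pi) := by
  have h (w : ℂ) : dbar (fun x => radialBump (x - z)) w = dbar radialBump (w - z) := by
    simp only [dbar, fderiv_comp_sub]
  simp only [h]
  rw [integral_sub_right_eq_self (fun w => dbar radialBump w / w) z]
  have h0 : (fun w => dbar radialBump w / w) =ᵐ[volume]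
      fun w : ℂ => ((2 * deriv cutoff (‖w‖ ^ 2) : ℝ) : ℂ) := by
    filter_upwards [compl_mem_ae_iff.mpr (measure_singleton (0 : ℂ))] with w hw
    have : w ≠ 0 := hw
    rw [dbar_radialBump]
    field_simp
    push_cast
    ring
  rw [integral_congr_ae h0, integral_complex_ofReal, integral_const_mul, integral_deriv_cutoff_norm_sq]
  push_cast
  ring

/-! ### Cauchy–Pompeiu formula -/

/-- The Cauchy–Pompeiu formula at a point near which the function is holomorphic. -/
lemma integral_dbar_div_sub {φ : ℂ → ℂ} (h : ContDiff ℝ 1 φ) (hc : HasCompactSupport φ) {z : ℂ}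
    (hz : AnalyticAt ℂ φ z) : ∫ w, dbar φ w / (w - z) = -(2 * Real.pi) * φ z := by
  set B : ℂ → ℂ := fun x => radialBump (x - z) with hB
  have hBd : ContDiff ℝ 1 B := contDiff_radialBump.comp (contDiff_id.sub contDiff_const)
  have hBc : HasCompactSupport B :=
    hasCompactSupport_radialBump.comp_homeomorph (Homeomorph.subRight z)
  have hB1 : B =ᶠ[𝓝 z] fun _ => 1 := by
    have : Tendsto (fun x : ℂ => x - z) (𝓝 z) (𝓝 0) := by
      have h0 : ContinuousAt (fun x : ℂ => x - z) z := by fun_prop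
      simpa [ContinuousAt] using h0
    exact this.eventually radialBump_eventuallyEq
  -- Subtracting a multiple of the bump makes `A` vanish at `z`. Then `A / (w - z)` extends to a
  -- compactly supported `C¹` function, whose `dbar` has integral zero; only the explicit bump
  -- integral remains.
  set A : ℂ → ℂ := fun x => φ x - B x * φ z with hA
  have hAd : ContDiff ℝ 1 A := h.sub (hBd.mul contDiff_const)
  have hAc : HasCompactSupport A := hc.sub (hBc.mul_right (f' := fun _ => φ z))
  have hAA : AnalyticAt ℂ A z := by
    have : A =ᶠ[𝓝 z] fun x => φ x - φ z := by
      filter_upwards [hB1] with x hx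
      simp [hA, hx]
    exact (hz.sub analyticAt_const).congr this.symm
  have hAz : A z = 0 := by simp [hA, hB1.self_of_nhds]
  set ψ : ℂ → ℂ := dslope A z with hψ
  have hψne {w : ℂ} (hw : w ≠ z) : ψ =ᶠ[𝓝 w] fun x => A x * (x - z)⁻¹ := by
    filter_upwards [isOpen_ne.mem_nhds hw] with x hx
    rw [hψ, dslope_of_ne _ hx, slope_def_field, hAz, sub_zero, div_eq_mul_inv]
  have hinv {w : ℂ} (hw : w ≠ z) : DifferentiableAt ℂ (fun x : ℂ => (x - z)⁻¹) w :=
    (differentiableAt_id.sub_const z).inv (sub_ne_zero.mpr hw)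
  have hψd : ContDiff ℝ 1 ψ := by
    rw [contDiff_iff_contDiffAt]
    intro w
    rcases eq_or_ne w z with rfl | hw
    · obtain ⟨s, hs, hsA⟩ := hAA.eventually_analyticAt.exists_mem
      have hd : DifferentiableOn ℂ A s := fun x hx => (hsA x hx).differentiableWithinAt
      have := ((differentiableOn_dslope hs).mpr hd).analyticAt hs
      exact this.contDiffAt.restrict_scalars ℝ
    · refine ContDiffAt.congr_of_eventuallyEq ?_ (hψne hw)
      refine hAd.contDiffAt.mul (ContDiffAt.inv (by fun_prop) (sub_ne_zero.mpr hw))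
  have hψc : HasCompactSupport ψ := by
    refine HasCompactSupport.intro (hAc.isCompact.insert z) fun w hw => ?_
    rw [mem_insert_iff, not_or] at hw
    simp [(hψne hw.1).self_of_nhds, image_eq_zero_of_notMem_tsupport hw.2]
  have hae : dbar ψ =ᵐ[volume]
      fun w => dbar φ w / (w - z) - dbar B w / (w - z) * φ z := by
    filter_upwards [compl_mem_ae_iff.mpr (measure_singleton z)] with w hw
    have hw : w ≠ z := hw
    rw [dbar_congr (hψne hw), dbar_mul (hAd.differentiable one_ne_zero w) (hinv hw), hA,
      dbar_sub (h.differentiable one_ne_zero w)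
        ((hBd.mul contDiff_const).differentiable one_ne_zero w),
      dbar_mul (hBd.differentiable one_ne_zero w) (differentiableAt_const _)]
    ring
  -- Analyticity at `z` makes `dbar θ` vanish near `z`, so the kernel's singularity is never seen.
  have hint {θ : ℂ → ℂ} (hd : ContDiff ℝ 1 θ) (hθ : HasCompactSupport θ)
      (hθz : AnalyticAt ℂ θ z) : Integrable fun w => dbar θ w / (w - z) := by
    refine Continuous.integrable_of_hasCompactSupport ?_ ?_
    · rw [continuous_iff_continuousAt]
      intro w
      rcases eq_or_ne w z with rfl | hw
      · have : (fun x => dbar θ x / (x - w)) =ᶠ[𝓝 w] fun _ => 0 := by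
          filter_upwards [hθz.eventually_analyticAt] with x hx
          simp [dbar_eq_zero hx.differentiableAt]
        exact continuousAt_const.congr this.symm
      · exact (continuous_dbar hd).continuousAt.div (by fun_prop) (sub_ne_zero.mpr hw)
    · simp only [div_eq_mul_inv]
      exact (hasCompactSupport_dbar hθ).mul_right (f' := fun w => (w - z)⁻¹)
  have hBA : AnalyticAt ℂ B z := analyticAt_const.congr hB1.symm
  have := integral_dbar_eq_zero hψd hψc
  rw [integral_congr_ae hae, integral_sub (hint h hc hz) ((hint hBd hBc hBA).mul_const _),
    integral_mul_const, integral_dbar_radialBump_div] at this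
  linear_combination this

/-! ### Runge's theorem -/

/-- The rational functions without poles on `K`, as a subspace of `C(K, ℂ)`. -/
def rationalSubmodule (K : Set ℂ) : Submodule ℂ C(K, ℂ) where
  carrier := {r | IsRationalPoleFree K r}
  zero_mem' := ⟨0, 1, by simp⟩
  add_mem' := by
    rintro r s ⟨p, q, h⟩ ⟨p', q', h'⟩
    refine ⟨p * q' + p' * q, q * q', fun z => ⟨?_, ?_⟩⟩
    · simpa using ⟨(h z).1, (h' z).1⟩
    · have h1 := (h z).1
      have h2 := (h' z).1
      simp only [ContinuousMap.add_apply, (h z).2, (h' z).2, Polynomial.eval_add,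
        Polynomial.eval_mul]
      field_simp
  smul_mem' := by
    rintro c r ⟨p, q, h⟩
    exact ⟨Polynomial.C c * p, q, fun z => ⟨(h z).1, by simp [(h z).2, mul_div_assoc]⟩⟩

/-- The quotient map by the closure is continuous linear, so it commutes with the integral, and it
kills every value of `F`. -/
lemma _root_.Submodule.integral_mem_topologicalClosure {E α : Type*} [NormedAddCommGroup E]
    [NormedSpace ℂ E] [CompleteSpace E] [MeasurableSpace α] {μ : Measure α} (S : Submodule ℂ E)
    {F : α → E} (hF : Integrable F μ) (hS : ∀ x, F x ∈ S) :
    ∫ x, F x ∂μ ∈ S.topologicalClosure := by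
  set T := S.topologicalClosure
  have : IsClosed (T : Set E) := S.isClosed_topologicalClosure
  have h0 (x : α) : T.mkQL (F x) = 0 := by
    simpa using S.le_topologicalClosure (hS x)
  have h1 := T.mkQL.integral_comp_comm hF
  simp only [h0, integral_zero] at h1
  simpa using h1.symm

/-- **Runge's theorem**, without control on the location of the poles. -/
theorem mem_closure_rationalSubmodule {K : Set ℂ} (hK : IsCompact K) (h : C(K, ℂ))
    (hext : ExtendsHolomorphically K h) :
    h ∈ closure (rationalSubmodule K : Set C(K, ℂ)) := by
  have : CompactSpace K := isCompact_iff_compactSpace.mp hK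
  obtain ⟨U, g, hU, hKU, hg, hgh⟩ := hext
  obtain ⟨L, hL, hKL, hLU⟩ := exists_compact_between hK hU hKU
  obtain ⟨χ, hχ1, hχ0, -⟩ := exists_contMDiffMap_one_nhds_of_subset_interior (n := 1)
    (modelWithCornersSelf ℝ ℂ) hK.isClosed hKL
  have hχd : ContDiff ℝ 1 χ := χ.contMDiff.contDiff
  have hχs : tsupport χ ⊆ L :=
    closure_minimal (fun x hx => by_contra fun hxL => hx (hχ0 x hxL)) hL.isClosed
  set φ : ℂ → ℂ := fun w => (χ w : ℂ) * g w with hφ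
  have hφd : ContDiff ℝ 1 φ := by
    rw [contDiff_iff_contDiffAt]
    intro w
    by_cases hw : w ∈ U
    · exact (ofRealCLM.contDiff.comp hχd).contDiffAt.mul
        ((hg.analyticAt (hU.mem_nhds hw)).contDiffAt.restrict_scalars ℝ)
    · have : φ =ᶠ[𝓝 w] fun _ => 0 := by
        filter_upwards [notMem_tsupport_iff_eventuallyEq.mp fun hw' => hw (hLU (hχs hw'))]
          with x hx
        simp [hφ, hx]
      exact contDiffAt_const.congr_of_eventuallyEq this
  have hφc : HasCompactSupport φ :=
    HasCompactSupport.intro hL fun w hw => by simp [hφ, hχ0 w hw]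
  have hφg {z : ℂ} (hz : z ∈ K) : φ =ᶠ[𝓝 z] g := by
    filter_upwards [hχ1.filter_mono (nhds_le_nhdsSet hz)] with x hx
    simp [hφ, hx]
  have hφA {z : ℂ} (hz : z ∈ K) : AnalyticAt ℂ φ z :=
    (hg.analyticAt (hU.mem_nhds (hKU hz))).congr (hφg hz).symm
  have hD {z : ℂ} (hz : z ∈ K) : ∀ᶠ w in 𝓝 z, dbar φ w = 0 := by
    filter_upwards [(hφA hz).eventually_analyticAt] with x hx
    exact dbar_eq_zero hx.differentiableAt
  have hcont : Continuous fun p : ℂ × K => dbar φ p.1 / (p.1 - p.2) := by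
    rw [continuous_iff_continuousAt]
    rintro ⟨w, z⟩
    by_cases hw : w ∈ K
    · have : (fun p : ℂ × K => dbar φ p.1 / (p.1 - p.2)) =ᶠ[𝓝 (w, z)] fun _ => 0 := by
        filter_upwards [continuousAt_fst.eventually (hD hw)] with p hp
        simp [hp]
      exact continuousAt_const.congr this.symm
    · refine ((continuous_dbar hφd).comp continuous_fst).continuousAt.div (by fun_prop) ?_
      exact sub_ne_zero.mpr (ne_of_mem_of_not_mem z.2 hw).symm
  -- Currying turns joint continuity into sup-norm continuity, so the integral of `F` converges
  -- uniformly on `K`.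
  set F : C(ℂ, C(K, ℂ)) := ContinuousMap.curry ⟨_, hcont⟩ with hF
  have hFapp (w : ℂ) (z : K) : F w z = dbar φ w / (w - z) := rfl
  have hFc : HasCompactSupport F := by
    refine HasCompactSupport.intro (hasCompactSupport_dbar hφc).isCompact fun w hw => ?_
    ext z
    simp [hFapp, image_eq_zero_of_notMem_tsupport hw]
  have hFi : Integrable F := F.continuous.integrable_of_hasCompactSupport hFc
  have hFS (w : ℂ) : F w ∈ rationalSubmodule K := by
    by_cases hw : w ∈ K
    · convert! (rationalSubmodule K).zero_mem
      ext z
      simp [hFapp, (hD hw).self_of_nhds]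
    · refine ⟨.C (dbar φ w), .C w - .X, fun z => ⟨?_, by simp [hFapp]⟩⟩
      simpa using sub_ne_zero.mpr (ne_of_mem_of_not_mem z.2 hw).symm
  have hmem := (rationalSubmodule K).topologicalClosure.smul_mem (-(2 * Real.pi : ℂ))⁻¹
    ((rationalSubmodule K).integral_mem_topologicalClosure hFi hFS)
  rw [← Submodule.topologicalClosure_coe, SetLike.mem_coe]
  convert hmem using 1
  ext z
  have heval : (∫ w, F w) z = ∫ w, F w z :=
    ((ContinuousMap.evalCLM ℂ z).integral_comp_comm hFi).symm
  have hpi : (2 * Real.pi : ℂ) ≠ 0 := by simp [Real.pi_ne_zero]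
  rw [ContinuousMap.smul_apply, heval]
  simp only [hFapp]
  rw [integral_dbar_div_sub hφd hφc (hφA z.2), (hφg z.2).self_of_nhds, hgh z, smul_eq_mul,
    inv_mul_cancel_left₀ (neg_ne_zero.mpr hpi)]

/-! ### Measurable selection -/

lemma measurableSet_forall_norm_sub_le {Ω : Type*} [MeasurableSpace Ω] {X : Type*}
    [TopologicalSpace X] [TopologicalSpace.SeparableSpace X] {f : Ω → X → ℂ} (hf : IsRandomFunction f)
    (hfc : ∀ ω, Continuous (f ω)) (r : C(X, ℂ)) (δ : ℝ) :
    MeasurableSet {ω | ∀ x, ‖r x - f ω x‖ ≤ δ} := by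
  obtain ⟨D, hDc, hD⟩ := TopologicalSpace.exists_countable_dense X
  have : {ω | ∀ x, ‖r x - f ω x‖ ≤ δ} = ⋂ x ∈ D, {ω | ‖r x - f ω x‖ ≤ δ} := by
    ext ω
    -- The non-strict bound is a closed condition on `x`, so it need only be checked on a countable
    -- dense set.
    simp only [mem_ofPred_eq, mem_iInter]
    refine ⟨fun h x _ => h x, fun h x => ?_⟩
    have hcl : IsClosed {x | ‖r x - f ω x‖ ≤ δ} :=
      isClosed_le ((r.continuous.sub (hfc ω)).norm) continuous_const
    exact hcl.closure_subset_iff.mpr h (hD x)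
  rw [this]
  exact .biInter hDc fun x _ =>
    measurableSet_le (measurable_const.sub (hf x)).norm measurable_const

/-- A random function whose realizations lie in the closure of a set `S ⊆ C(X, ℂ)` is uniformly
approximated by random functions with realizations in `S`. -/
theorem exists_randomFunction_approx {Ω : Type*} [MeasurableSpace Ω] {X : Type*}
    [MetricSpace X] [CompactSpace X] (S : Set C(X, ℂ)) (hS : S.Nonempty) {f : Ω → C(X, ℂ)}
    (hf : IsRandomFunction fun ω x => f ω x) (hfS : ∀ ω, f ω ∈ closure S) {ε : ℝ} (hε : 0 < ε) :
    ∃ r : Ω → C(X, ℂ), IsRandomFunction (fun ω x => r ω x) ∧ (∀ ω, r ω ∈ S) ∧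
      ∀ ω x, ‖r ω x - f ω x‖ < ε := by
  classical
  have : Nonempty S := hS.to_subtype
  set s : ℕ → C(X, ℂ) := fun n => (TopologicalSpace.denseSeq S n : C(X, ℂ)) with hs
  -- `ε / 4` is spent on reaching `S` and `ε / 4` on the dense sequence; the bound `≤ ε / 2` then
  -- yields the strict `< ε`.
  have hex (ω : Ω) : ∃ n, ∀ x, ‖s n x - f ω x‖ ≤ ε / 2 := by
    obtain ⟨t, htS, ht⟩ := Metric.mem_closure_iff.mp (hfS ω) (ε / 4) (by positivity)
    obtain ⟨n, hn⟩ := (TopologicalSpace.denseRange_denseSeq S).exists_dist_lt ⟨t, htS⟩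
      (show 0 < ε / 4 by positivity)
    refine ⟨n, fun x => ?_⟩
    rw [← dist_eq_norm]
    refine (ContinuousMap.dist_apply_le_dist (f := s n) (g := f ω) x).trans ?_
    have h1 : dist t (s n) < ε / 4 := hn
    linarith [dist_triangle_left (s n) (f ω) t, dist_comm (f ω) t]
  have hm (n : ℕ) : MeasurableSet {ω | ∀ x, ‖s n x - f ω x‖ ≤ ε / 2} :=
    measurableSet_forall_norm_sub_le hf (fun ω => (f ω).continuous) (s n) _
  have hN : Measurable fun ω => Nat.find (hex ω) := measurable_find hex hm
  refine ⟨fun ω => s (Nat.find (hex ω)), fun x => ?_, fun ω => (TopologicalSpace.denseSeq S _).2,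
    fun ω x => (Nat.find_spec (hex ω) x).trans_lt (half_lt_self hε)⟩
  exact (measurable_from_nat (f := fun n => s n x)).comp hN

lemma ExtendsHolomorphically.continuous {K : Set ℂ} {h : K → ℂ}
    (hh : ExtendsHolomorphically K h) : Continuous h := by
  obtain ⟨U, g, -, hKU, hg, hgh⟩ := hh
  rw [funext hgh]
  exact (hg.continuousOn.mono hKU).domRestrict

lemma ExtendsHolomorphically.isHolomorphicOnInterior {K : Set ℂ} {h : K → ℂ}
    (hh : ExtendsHolomorphically K h) : IsHolomorphicOnInterior K h := by
  obtain ⟨U, g, -, hKU, hg, hgh⟩ := hh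
  exact ⟨g, hg.mono (interior_subset.trans hKU), fun z _ => hgh z⟩

end RandomRunge

theorem mainTheorem3 {Ω : Type*} [MeasurableSpace Ω] (K : Set ℂ) (hK : IsCompact K)
    (hKne : K.Nonempty) (f : Ω → K → ℂ) (hf : RandomRunge.IsRandomFunction f)
    (hext : ∀ ω, RandomRunge.ExtendsHolomorphically K (f ω)) :
    f ∈ RandomRunge.RUnif Ω K := by
  have : CompactSpace K := isCompact_iff_compactSpace.mp hK
  refine ⟨hf, fun ω => (hext ω).continuous, fun ω => (hext ω).isHolomorphicOnInterior,
    fun ε hε => ?_⟩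
  obtain ⟨r, hr, hrS, hrf⟩ := RandomRunge.exists_randomFunction_approx
    (RandomRunge.rationalSubmodule K : Set C(K, ℂ)) ⟨0, zero_mem _⟩
    (f := fun ω => ⟨f ω, (hext ω).continuous⟩) hf
    (fun ω => RandomRunge.mem_closure_rationalSubmodule hK _ (hext ω)) hε
  exact ⟨fun ω z => r ω z, ⟨hr, hrS⟩, hrf⟩
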